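/- An infinite step billiard is the billiard in a table $P=\bigcup_{n\ge 0}[n,n+1]\times[0,p_n]$, where $1=p_0\ge p_1\ge p_2\ge\dots$, $p_n>0$ for all $n$ and $p_n\to 0$: a point moves with unit speed in $P$ and is reflected elastically at the sides. For $\vartheta\in(0,\pi/2)$, the trajectories whose velocities are of the form $(\pm\cos\vartheta,\pm\sin\vartheta)$ are described, by unfolding, on the invariant surface $S(\vartheta)$. This is the region $\{(X,Y):(|X|,|Y|)\in P\}$ with sides glued as follows: $(X,p_n)\sim(X,-p_n)$ for $n\le|X|\le n+1$, $n\ge 0$, and $(n,Y)\sim(-n,Y)$ for $n\ge1$, $p_n\le|Y|\le p_{n-1}$. The flow $\phi_t$ $(t\in\mathbb R)$ on $S(\vartheta)$ moves points with constant velocity $(\cos\vartheta,\sin\vartheta)$, and the position on the table is $(|X|,|Y|)$. A trajectory that hits a singular vertex (one of the points $(\pm n,\pm p_n)$, $n\ge1$) is continued as the limit of the parallel trajectories immediately above it in the coordinates $(X,Y)$ (vertical cross-sections are half-open intervals, closed below and open above, and a singular vertex is counted as several points, one for each trajectory that leaves it). So every trajectory is defined for all $t\in\mathbb R$. A trajectory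 is periodic if it returns to its initial point of $S(\vartheta)$ after some time $T>0$. A trajectory, or a forward ($t\ge0$) or backward ($t\le 0$) semi-orbit, is unbounded if its set of positions is unbounded in the plane. Proposition. (a) For every infinite step billiard and for Lebesgue-almost every direction $\vartheta\in(0,\pi/2)$, all semi-orbits, forward and backward, of all points of $S(\vartheta)$ are unbounded. (b) For every infinite step billiard, the set of directions $\vartheta\in(0,\pi/2)$ in which there are both a periodic trajectory and an unbounded trajectory has Lebesgue measure zero. (c) Such coexistence does occur: there are an infinite step billiard and a direction $\vartheta\in(0,\pi/2)$ in which there are both a periodic trajectory and an unbounded trajectory. -/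

import Mathlib

open MeasureTheory Set Filter Topology

/-- An infinite step billiard, given by a sequence of heights `1 = p 0 ≥ p 1 ≥ p 2 ≥ ⋯ > 0`
that tends to `0`. -/
structure StepBilliard where
  p : ℕ → ℝ
  p_zero : p 0 = 1
  p_pos : ∀ n, 0 < p n
  p_antitone : Antitone p
  p_tendsto : Tendsto p atTop (𝓝 0)

noncomputable section

namespace StepBilliard

variable (B : StepBilliard)

/-- The table `⋃ n, [n, n + 1] × [0, p n]`. -/
def table : Set (ℝ × ℝ) :=
  ⋃ n : ℕ, Icc (n : ℝ) (n + 1) ×ˢ Icc 0 (B.p n)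

/-- For `k ∈ ℤ`, the height of the table over the image `[n, n + 1]` of `[k, k + 1]` under
`X ↦ |X|`: here `n = k` if `0 ≤ k`, and `n = -k - 1` if `k < 0`. -/
def height : ℤ → ℝ
  | Int.ofNat n => B.p n
  | Int.negSucc n => B.p n

/-- The interval `[-h, h)`, where `h` is the height of the table over the column
`k ≤ |X| ≤ k + 1`. The points with ordinates `h` and `-h` are identified. -/
def fiber (k : ℤ) : Set ℝ := Ico (-B.height k) (B.height k)

theorem height_pos (k : ℤ) : 0 < B.height k := by
  cases k <;> exact B.p_pos _

theorem height_neg (j : ℤ) : B.height (-j) = B.height (j - 1) := by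
  rcases j with (_ | n) | n
  · show B.p 0 = B.p 0
    rfl
  · have h1 : -(Int.ofNat (n + 1)) = Int.negSucc n := rfl
    have h2 : Int.ofNat (n + 1) - 1 = Int.ofNat n := by simp
    rw [h1, h2]
    rfl
  · have h1 : -(Int.negSucc n) = Int.ofNat (n + 1) := rfl
    have h2 : Int.negSucc n - 1 = Int.negSucc (n + 1) := rfl
    rw [h1, h2]
    rfl

theorem fiber_neg (j : ℤ) : B.fiber (-j) = B.fiber (j - 1) := by
  simp only [fiber, height_neg]

theorem fiber_neg_sub_one (j : ℤ) : B.fiber (-j - 1) = B.fiber j := by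
  rw [show -j - 1 = -(j + 1) by ring, fiber_neg]
  simp

/-- The representative in `[-h, h)` of a real number modulo `2 * h`, where `h` is the height of
the `k`-th column: the horizontal sides at ordinates `h` and `-h` are glued by translation. -/
def wrap (k : ℤ) (y : ℝ) : ℝ :=
  toIcoMod (mul_pos two_pos (B.height_pos k)) (-B.height k) y

theorem wrap_mem (k : ℤ) (y : ℝ) : B.wrap k y ∈ B.fiber k := by
  have h := toIcoMod_mem_Ico (mul_pos two_pos (B.height_pos k)) (-B.height k) y
  rwa [show -B.height k + 2 * B.height k = B.height k by ring] at h

theorem wrap_of_mem {k : ℤ} {y : ℝ} (hy : y ∈ B.fiber k) : B.wrap k y = y := by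
  rw [wrap, toIcoMod_eq_self, show -B.height k + 2 * B.height k = B.height k by ring]
  exact hy

theorem wrap_wrap_add (k : ℤ) (y a : ℝ) : B.wrap k (B.wrap k y + a) = B.wrap k (y + a) := by
  simp only [wrap]
  rw [toIcoMod_eq_toIcoMod]
  refine ⟨toIcoDiv (mul_pos two_pos (B.height_pos k)) (-B.height k) y, ?_⟩
  rw [toIcoMod]
  ring

/-- The invariant surface: the four reflected copies `{(X, Y) | (|X|, |Y|) ∈ table}` of the
table, with opposite sides glued by translation: `(X, p n)` with `(X, -p n)` for
`n ≤ |X| ≤ n + 1`, and `(n, Y)` with `(-n, Y)` for `n ≥ 1`, `p n ≤ |Y| ≤ p (n - 1)`.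

The point `(X, Y)` stands for the position `(|X|, |Y|)` together with one of the four directions
`(± cos θ, ± sin θ)`: the horizontal sign is `+` if `0 ≤ X` and `-` if `X < 0`, the vertical
sign is `+` if `0 ≤ Y` and `-` if `Y < 0`. In these coordinates the motion always has velocity
`(cos θ, sin θ)`, and a reflection at `x = 0` or `y = 0` becomes a passage through `X = 0` or
`Y = 0`, while reflections at the other sides become passages through glued sides.
Of two glued side points the representative from
which the motion with that velocity stays in the region is chosen: a top side is replaced by the
bottom side, and the right-hand wall `{n} × ±[p n, p (n - 1)]` by the left-hand wall
`{-n} × ±[p n, p (n - 1)]`. (A singular vertex is thereby represented by three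
points, `(n, -p n)`, `(-n, p n)` and `(-n, -p n)`, one for each trajectory that leaves it.) -/
def Surface : Type := {z : ℝ × ℝ // z.2 ∈ B.fiber ⌊z.1⌋}

variable {B} in
/-- The position on the table of a point of the invariant surface. -/
def Surface.position (z : B.Surface) : ℝ × ℝ := (|z.1.1|, |z.1.2|)

theorem position_mem_table (z : B.Surface) : z.position ∈ B.table := by
  obtain ⟨⟨X, Y⟩, hz⟩ := z
  have hz' : Y ∈ B.fiber ⌊X⌋ := hz
  have h1 : |Y| ≤ B.height ⌊X⌋ := abs_le.mpr ⟨hz'.1, hz'.2.le⟩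
  have h2 := Int.floor_le X
  have h3 := (Int.lt_floor_add_one X).le
  revert h1 h2 h3
  generalize ⌊X⌋ = k
  intro h1 h2 h3
  rcases k with n | n
  · have h0 : (0 : ℝ) ≤ n := n.cast_nonneg
    simp only [Int.ofNat_eq_natCast, Int.cast_natCast] at h2 h3
    refine mem_iUnion.mpr ⟨n, ⟨?_, ?_⟩, abs_nonneg Y, h1⟩ <;>
      simp only [Surface.position] <;> rw [abs_of_nonneg (h0.trans h2)] <;> assumption
  · have h0 : (0 : ℝ) ≤ n := n.cast_nonneg
    rw [Int.cast_negSucc] at h2 h3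
    push_cast at h2 h3
    refine mem_iUnion.mpr ⟨n, ⟨?_, ?_⟩, abs_nonneg Y, h1⟩ <;>
      simp only [Surface.position] <;> rw [abs_of_nonpos (by linarith)] <;> linarith

/-- The left edges `{k} × [-h, h)` of the columns `[k, k + 1] × [-h, h)` of the surface. -/
def LeftEdge : Type := {c : ℤ × ℝ // c.2 ∈ B.fiber c.1}

/-- The right edges of the columns; `(j, y)` lies on the right edge of the column that ends at
abscissa `j`. -/
def RightEdge : Type := {c : ℤ × ℝ // c.2 ∈ B.fiber (c.1 - 1)}

/-- Straight motion of slope `tan θ` across a column, from its left edge to its right edge. -/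
def traverse (θ : ℝ) : B.LeftEdge ≃ B.RightEdge where
  toFun c := ⟨(c.1.1 + 1, B.wrap c.1.1 (c.1.2 + Real.tan θ)), by
    simpa using B.wrap_mem c.1.1 (c.1.2 + Real.tan θ)⟩
  invFun c := ⟨(c.1.1 - 1, B.wrap (c.1.1 - 1) (c.1.2 - Real.tan θ)),
    B.wrap_mem (c.1.1 - 1) (c.1.2 - Real.tan θ)⟩
  left_inv := by
    rintro ⟨⟨k, y⟩, hy⟩
    apply Subtype.ext
    simp only [add_sub_cancel_right, sub_eq_add_neg (B.wrap _ _), wrap_wrap_add,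
      add_neg_cancel_right]
    rw [B.wrap_of_mem hy]
  right_inv := by
    rintro ⟨⟨k, y⟩, hy⟩
    apply Subtype.ext
    simp only [wrap_wrap_add, sub_add_cancel]
    rw [B.wrap_of_mem hy]

/-- Passage from the right edge of a column to the left edge of a column, at abscissa `j`. If the
next column is open at height `y`, the point moves on into it; otherwise it hits the vertical
wall at abscissa `j`, which is glued to the wall at abscissa `-j`. At a singular vertex this is
the limit from above: the intervals `[-h, h)` are closed below and open above. -/
def glue : B.RightEdge ≃ B.LeftEdge where
  toFun c :=
    open Classical in
    ⟨(if c.1.2 ∈ B.fiber c.1.1 then c.1.1 else -c.1.1, c.1.2), by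
      split_ifs with h
      · exact h
      · exact (B.fiber_neg c.1.1).symm ▸ c.2⟩
  invFun c :=
    open Classical in
    ⟨(if c.1.2 ∈ B.fiber (c.1.1 - 1) then c.1.1 else -c.1.1, c.1.2), by
      split_ifs with h
      · exact h
      · exact (B.fiber_neg_sub_one c.1.1).symm ▸ c.2⟩
  left_inv := by
    rintro ⟨⟨j, y⟩, hy⟩
    have hy' : y ∈ B.fiber (j - 1) := hy
    apply Subtype.ext
    by_cases h : y ∈ B.fiber j <;> simp [h, hy', fiber_neg_sub_one]
  right_inv := by
    rintro ⟨⟨j, y⟩, hy⟩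
    have hy' : y ∈ B.fiber j := hy
    apply Subtype.ext
    by_cases h : y ∈ B.fiber (j - 1) <;> simp [h, hy', fiber_neg]

/-- The motion in direction `θ` from the left edge of a column to the left edge of the column
that is entered next. -/
def cross (θ : ℝ) : Equiv.Perm B.LeftEdge := (B.traverse θ).trans B.glue

/-- The billiard flow at time `t` on the invariant surface of direction `θ ∈ (0, π / 2)`: motion
with velocity `(cos θ, sin θ)` and the gluings above. The point `(X, Y)` is first moved back
along its trajectory to the left edge of its column; from there the abscissa has to
increase by `u = (X - ⌊X⌋) + t cos θ`, that is, `⌊u⌋` columns are crossed (backwards if `u < 0`)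
and the abscissa then increases by the remaining `u - ⌊u⌋ ∈ [0, 1)`. -/
def flow (θ t : ℝ) (z : B.Surface) : B.Surface :=
  let u : ℝ := Int.fract z.1.1 + t * Real.cos θ
  let start : B.LeftEdge :=
    ⟨(⌊z.1.1⌋, B.wrap ⌊z.1.1⌋ (z.1.2 - Int.fract z.1.1 * Real.tan θ)), B.wrap_mem _ _⟩
  let c : B.LeftEdge := (B.cross θ ^ ⌊u⌋) start
  ⟨((c.1.1 : ℝ) + Int.fract u, B.wrap c.1.1 (c.1.2 + Int.fract u * Real.tan θ)), by
    have h : ⌊(c.1.1 : ℝ) + Int.fract u⌋ = c.1.1 := by simp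
    simpa only [h] using B.wrap_mem c.1.1 (c.1.2 + Int.fract u * Real.tan θ)⟩

/-- The forward semi-orbit, as a subset of the table. -/
def forwardSemiOrbit (θ : ℝ) (z : B.Surface) : Set (ℝ × ℝ) :=
  (fun t : ℝ => (B.flow θ t z).position) '' Ici 0

/-- The backward semi-orbit, as a subset of the table. -/
def backwardSemiOrbit (θ : ℝ) (z : B.Surface) : Set (ℝ × ℝ) :=
  (fun t : ℝ => (B.flow θ t z).position) '' Iic 0

/-- The whole trajectory, as a subset of the table. -/
def trajectory (θ : ℝ) (z : B.Surface) : Set (ℝ × ℝ) :=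
  range fun t : ℝ => (B.flow θ t z).position

/-- The trajectory of `z` in direction `θ` is periodic. -/
def IsPeriodic (θ : ℝ) (z : B.Surface) : Prop :=
  ∃ T : ℝ, 0 < T ∧ B.flow θ T z = z

/-- In direction `θ` there are both a periodic and an unbounded trajectory. -/
def PeriodicUnboundedCoexist (θ : ℝ) : Prop :=
  (∃ z : B.Surface, B.IsPeriodic θ z) ∧
    ∃ w : B.Surface, ¬ Bornology.IsBounded (B.trajectory θ w)

end StepBilliard

end

noncomputable section

/-!
The edge-to-edge map of the flow is an exchange of infinitely many intervals, finitely many in each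
column. Following a trajectory changes the height by a multiple of `tan θ`, up to the countable
group generated by the heights of the table. So for all but countably many `θ` no trajectory closes
up and none joins two corners; this is Keane's condition.

Let `W` be the set of points whose forward orbit stays in finitely many columns. Consider, for an
orbit in `W`, the gaps to the right of its points. Only finitely many of them are ever cut by a
discontinuity, and all others keep their length. There is no room for infinitely many of them, so
the orbit returns to its initial point from the right. Consequently `W` is backward invariant.
It is then closed upwards and downwards in each column: an end of `W` would travel forwards and
backwards without leaving the finitely many ends of `W`, unless it meets a discontinuity both ways,
which Keane's condition forbids. Hence `W` is a union of whole columns. Since the midpoint of the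
next column is reached from each column, `W` would contain infinitely many columns if it contained
one, so it is empty.

For the heights `2⁻ⁿ` and slope `1`, the orbit of the midpoint of the second column passes through
all later midpoints, while the orbit of height `1/4` on the left edge of the first column has
period 2.
-/

/-! ### Interval exchanges -/

section FiniteSets

variable {α : Type*} {s : Set α} {a c : α}

theorem exists_mem_Ioc_disjoint_Ioc_of_finite [Preorder α] [DenselyOrdered α] (hs : s.Finite)
    (hac : a < c) : ∃ b ∈ Ioc a c, Disjoint (Ioc a b) s := by
  induction s, hs using Set.Finite.induction_on with
  | empty => exact ⟨c, right_mem_Ioc.mpr hac, disjoint_empty _⟩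
  | @insert d s _ _ ih =>
    obtain ⟨b, hb, hbs⟩ := ih
    by_cases hd : d ∈ Ioc a b
    · obtain ⟨b', hab', hb'd⟩ := exists_between hd.1
      have hb'b : b' ≤ b := hb'd.le.trans hd.2
      refine ⟨b', ⟨hab', hb'b.trans hb.2⟩, disjoint_insert_right.mpr ⟨fun h => ?_, ?_⟩⟩
      · exact (hb'd.trans_le h.2).false
      · exact hbs.mono_left (Ioc_subset_Ioc_right hb'b)
    · exact ⟨b, hb, disjoint_insert_right.mpr ⟨hd, hbs⟩⟩

theorem exists_mem_Ico_disjoint_Ioc_of_finite [PartialOrder α] (hs : s.Finite)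
    (hac : a < c) (hc : c ∉ s) : ∃ b ∈ Ico a c, Disjoint (Ioc b c) s := by
  induction s, hs using Set.Finite.induction_on with
  | empty => exact ⟨a, left_mem_Ico.mpr hac, disjoint_empty _⟩
  | @insert d s _ _ ih =>
    rw [mem_insert_iff, not_or] at hc
    obtain ⟨b, hb, hbs⟩ := ih hc.2
    by_cases hd : d ∈ Ioc b c
    · refine ⟨d, ⟨hb.1.trans hd.1.le, hd.2.lt_of_ne' hc.1⟩, disjoint_insert_right.mpr ⟨?_, ?_⟩⟩
      · exact fun h => h.1.false
      · exact hbs.mono_left (Ioc_subset_Ioc_left hd.1.le)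
    · exact ⟨b, hb, disjoint_insert_right.mpr ⟨hd, hbs⟩⟩

end FiniteSets

/-- The disjoint union of the half-open intervals `[lo i, hi i)`, the phase space of an interval
exchange. It is ordered as a sum: only points of the same interval are comparable. -/
def IntervalSum {ι : Type*} (lo hi : ι → ℝ) : Type _ :=
  {c : ι × ℝ // c.2 ∈ Ico (lo c.1) (hi c.1)}

namespace IntervalSum

variable {ι : Type*} {lo hi : ι → ℝ}

instance : PartialOrder (IntervalSum lo hi) where
  le a b := a.1.1 = b.1.1 ∧ a.1.2 ≤ b.1.2
  le_refl _ := ⟨rfl, le_rfl⟩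
  le_trans _ _ _ hab hbc := ⟨hab.1.trans hbc.1, hab.2.trans hbc.2⟩
  le_antisymm _ _ hab hba := Subtype.ext (Prod.ext hab.1 (le_antisymm hab.2 hba.2))

variable {a b c e : IntervalSum lo hi}

theorem le_def : a ≤ b ↔ a.1.1 = b.1.1 ∧ a.1.2 ≤ b.1.2 := Iff.rfl

theorem lt_def : a < b ↔ a.1.1 = b.1.1 ∧ a.1.2 < b.1.2 := by
  rw [lt_iff_le_not_ge, le_def, le_def]
  constructor
  · rintro ⟨⟨hidx, -⟩, h⟩
    exact ⟨hidx, not_le.mp fun h' => h ⟨hidx.symm, h'⟩⟩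
  · rintro ⟨hidx, h⟩
    exact ⟨⟨hidx, h.le⟩, fun h' => h'.2.not_gt h⟩

theorem le_or_gt_of_fst_eq (h : a.1.1 = b.1.1) : a ≤ b ∨ b < a :=
  (le_or_gt a.1.2 b.1.2).imp (le_def.mpr ⟨h, ·⟩) (lt_def.mpr ⟨h.symm, ·⟩)

theorem exists_mem_Icc (hab : a ≤ b) {y : ℝ} (hy : y ∈ Icc a.1.2 b.1.2) :
    ∃ x ∈ Icc a b, x.1.2 = y :=
  have hyb : y < hi a.1.1 := hab.1 ▸ hy.2.trans_lt b.2.2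
  ⟨⟨(a.1.1, y), a.2.1.trans hy.1, hyb⟩, ⟨⟨rfl, hy.1⟩, ⟨hab.1, hy.2⟩⟩, rfl⟩

theorem exists_mem_Ioc (hab : a ≤ b) {y : ℝ} (hy : y ∈ Ioc a.1.2 b.1.2) :
    ∃ x ∈ Ioc a b, x.1.2 = y := by
  obtain ⟨x, hx, rfl⟩ := exists_mem_Icc hab (Ioc_subset_Icc_self hy)
  exact ⟨x, ⟨lt_def.mpr ⟨hx.1.1, hy.1⟩, hx.2⟩, rfl⟩

instance : DenselyOrdered (IntervalSum lo hi) where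
  dense a b hab := by
    obtain ⟨y, hay, hyb⟩ := exists_between (lt_def.mp hab).2
    obtain ⟨x, hx, rfl⟩ := exists_mem_Icc hab.le ⟨hay.le, hyb.le⟩
    exact ⟨x, lt_def.mpr ⟨hx.1.1, hay⟩, lt_def.mpr ⟨hx.2.1, hyb⟩⟩

instance : NoMaxOrder (IntervalSum lo hi) where
  exists_gt a := by
    obtain ⟨y, hay, hyb⟩ := exists_between a.2.2
    exact ⟨⟨(a.1.1, y), a.2.1.trans hay.le, hyb⟩, lt_def.mpr ⟨rfl, hay⟩⟩

theorem exists_isLUB {s : Set (IntervalSum lo hi)} (hs : s ⊆ Icc a b) (hne : s.Nonempty) :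
    ∃ x ∈ Icc a b, IsLUB s x := by
  have hcoord : (fun c : IntervalSum lo hi => c.1.2) '' s ⊆ Icc a.1.2 b.1.2 := by
    rintro _ ⟨c, hc, rfl⟩
    exact ⟨(hs hc).1.2, (hs hc).2.2⟩
  have hlub := isLUB_csSup (hne.image _) (bddAbove_Icc.mono hcoord)
  obtain ⟨c₀, hc₀⟩ := hne
  obtain ⟨x, hx, hxs⟩ := exists_mem_Icc ((hs hc₀).1.trans (hs hc₀).2)
    ⟨(hs hc₀).1.2.trans (hlub.1 ⟨c₀, hc₀, rfl⟩), hlub.2 fun y hy => (hcoord hy).2⟩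
  refine ⟨x, hx, fun c hc => ⟨(hs hc).1.1.symm.trans hx.1.1, ?_⟩, fun u hu => ⟨?_, ?_⟩⟩
  · exact hxs ▸ hlub.1 ⟨c, hc, rfl⟩
  · exact hx.1.1.symm.trans ((hs hc₀).1.1.trans (hu hc₀).1)
  · rw [hxs]
    exact hlub.2 (forall_mem_image.mpr fun c hc => (hu hc).2)

theorem exists_isGLB {s : Set (IntervalSum lo hi)} (hs : s ⊆ Icc a b) (hne : s.Nonempty) :
    ∃ x ∈ Icc a b, IsGLB s x := by
  obtain ⟨c₀, hc₀⟩ := hne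
  have hab := (hs hc₀).1.trans (hs hc₀).2
  obtain ⟨x, hx, hlub⟩ := exists_isLUB (s := lowerBounds s ∩ Icc a b) inter_subset_right
    ⟨a, fun c hc => (hs hc).1, left_mem_Icc.mpr hab⟩
  refine ⟨x, hx, fun c hc => hlub.2 fun u hu => hu.1 hc, fun u hu => ?_⟩
  rcases le_or_gt_of_fst_eq ((hu hc₀).1.trans (hs hc₀).1.1.symm) with hua | hau
  · exact hua.trans hx.1
  · exact hlub.1 ⟨hu, hau.le, (hu hc₀).trans (hs hc₀).2⟩

theorem exists_lt_sub_lt {F : Set ι} (hF : F.Finite) {u : ℕ → IntervalSum lo hi}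
    (hu : Function.Injective u) (huF : ∀ n, (u n).1.1 ∈ F) {r : ℝ} (hr : 0 < r) :
    ∃ m n, u m < u n ∧ (u n).1.2 - (u m).1.2 < r := by
  let cell : IntervalSum lo hi → ι × ℤ := fun c => (c.1.1, ⌊c.1.2 / r⌋)
  have hfin : (⋃ i ∈ F, {i} ×ˢ Icc ⌊lo i / r⌋ ⌊hi i / r⌋).Finite :=
    hF.biUnion fun i _ => (finite_singleton i).prod (finite_Icc _ _)
  have hmaps : MapsTo cell (range u) (⋃ i ∈ F, {i} ×ˢ Icc ⌊lo i / r⌋ ⌊hi i / r⌋) := by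
    rintro _ ⟨n, rfl⟩
    exact mem_iUnion₂.mpr ⟨_, huF n, rfl,
      Int.floor_le_floor (div_le_div_of_nonneg_right (u n).2.1 hr.le),
      Int.floor_le_floor (div_le_div_of_nonneg_right (u n).2.2.le hr.le)⟩
  obtain ⟨_, ⟨m, rfl⟩, _, ⟨n, rfl⟩, hne, heq⟩ :=
    (infinite_range_of_injective hu).exists_ne_map_eq_of_mapsTo hmaps hfin
  have hdist : |(u m).1.2 / r - (u n).1.2 / r| < 1 :=
    Int.abs_sub_lt_one_of_floor_eq_floor (Prod.ext_iff.mp heq).2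
  rw [← sub_div, abs_div, abs_of_pos hr, div_lt_one hr, abs_sub_lt_iff] at hdist
  rcases le_or_gt_of_fst_eq (Prod.ext_iff.mp heq).1 with hmn | hnm
  · exact ⟨m, n, hmn.lt_of_ne hne, hdist.2⟩
  · exact ⟨n, m, hnm, hdist.1⟩

/-- `D` has finitely many points in each interval. -/
def IsLocallyFinite (D : Set (IntervalSum lo hi)) : Prop :=
  ∀ i, {c ∈ D | c.1.1 = i}.Finite

/-- The bijection `T` is a translation between consecutive points of `D`. Since only the points of
`(a, b]` have to avoid `D`, such a `T` is continuous from the right even at the points of `D`. -/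
def IsTranslationOff (T : Equiv.Perm (IntervalSum lo hi)) (D : Set (IntervalSum lo hi)) : Prop :=
  ∀ a b, a ≤ b → Disjoint (Ioc a b) D → T a ≤ T b ∧ (T b).1.2 - (T a).1.2 = b.1.2 - a.1.2

/-- The points whose forward orbit under `T` stays in the intervals with index in `F`. -/
def confined (T : Equiv.Perm (IntervalSum lo hi)) (F : Set ι) : Set (IntervalSum lo hi) :=
  {c | ∀ n : ℕ, ((T ^ n) c).1.1 ∈ F}

variable {T : Equiv.Perm (IntervalSum lo hi)} {F : Set ι} {D D' : Set (IntervalSum lo hi)}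

namespace IsLocallyFinite

theorem insert (hD : IsLocallyFinite D) (d : IntervalSum lo hi) :
    IsLocallyFinite (insert d D) := by
  refine fun i => ((hD i).insert d).subset ?_
  rintro c ⟨rfl | hc, hi⟩
  exacts [mem_insert c _, mem_insert_of_mem d ⟨hc, hi⟩]

theorem union (hD : IsLocallyFinite D) (hD' : IsLocallyFinite D') : IsLocallyFinite (D ∪ D') := by
  refine fun i => ((hD i).union (hD' i)).subset ?_
  rintro c ⟨hc | hc, hi⟩
  exacts [Or.inl ⟨hc, hi⟩, Or.inr ⟨hc, hi⟩]

theorem finite_sep_fst_mem (hD : IsLocallyFinite D) (hF : F.Finite) :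
    {c ∈ D | c.1.1 ∈ F}.Finite :=
  (hF.biUnion fun i _ => hD i).subset fun _ hc => mem_iUnion₂.mpr ⟨_, hc.2, hc.1, rfl⟩

theorem exists_mem_Ioc_disjoint (hD : IsLocallyFinite D) (hac : a < c) :
    ∃ b ∈ Ioc a c, Disjoint (Ioc a b) D := by
  obtain ⟨b, hb, hdisj⟩ := exists_mem_Ioc_disjoint_Ioc_of_finite (hD a.1.1) hac
  exact ⟨b, hb, disjoint_left.mpr fun d hd hdD =>
    disjoint_left.mp hdisj hd ⟨hdD, hd.1.le.1.symm⟩⟩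

theorem exists_mem_Ico_disjoint (hD : IsLocallyFinite D) (hac : a < c) (hc : c ∉ D) :
    ∃ b ∈ Ico a c, Disjoint (Ioc b c) D := by
  obtain ⟨b, hb, hdisj⟩ := exists_mem_Ico_disjoint_Ioc_of_finite (hD c.1.1) hac (hc ·.1)
  exact ⟨b, hb, disjoint_left.mpr fun d hd hdD => disjoint_left.mp hdisj hd ⟨hdD, hd.2.1⟩⟩

end IsLocallyFinite

theorem fst_mem_of_mem_confined (hc : c ∈ confined T F) : c.1.1 ∈ F := hc 0

theorem mem_confined_iff : c ∈ confined T F ↔ c.1.1 ∈ F ∧ T c ∈ confined T F := by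
  refine ⟨fun h => ⟨h 0, fun n => h (n + 1)⟩, fun h n => ?_⟩
  cases n with
  | zero => exact h.1
  | succ n => exact h.2 n

theorem pow_apply_mem_confined (hc : c ∈ confined T F) (n : ℕ) : (T ^ n) c ∈ confined T F := by
  intro m
  rw [← Equiv.Perm.mul_apply, ← pow_add]
  exact hc (m + n)

namespace IsTranslationOff

theorem lt (hT : IsTranslationOff T D) (hab : a < b)
    (hD : Disjoint (Ioc a b) D) : T a < T b :=
  (hT a b hab.le hD).1.lt_of_ne (T.injective.ne hab.ne)

theorem exists_apply_eq (hT : IsTranslationOff T D) (hab : a ≤ b)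
    (hD : Disjoint (Ioc a b) D) {w : IntervalSum lo hi} (hw : w ∈ Icc (T a) (T b)) :
    ∃ x ∈ Icc a b, T x = w := by
  obtain ⟨-, hlen⟩ := hT a b hab hD
  have hy : a.1.2 + (w.1.2 - (T a).1.2) ∈ Icc a.1.2 b.1.2 := by
    constructor <;> linarith [hw.1.2, hw.2.2]
  obtain ⟨x, hx, hxy⟩ := exists_mem_Icc hab hy
  obtain ⟨hle, hlen'⟩ := hT a x hx.1 (hD.mono_left (Ioc_subset_Ioc_right hx.2))
  exact ⟨x, hx, Subtype.ext (Prod.ext (hle.1.symm.trans hw.1.1) (by linarith))⟩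

theorem Ioo_subset_image (hT : IsTranslationOff T D) (hab : a < b) (hD : Disjoint (Ioc a b) D) :
    Ioo (T a) (T b) ⊆ T '' Ioo a b := by
  intro w hw
  obtain ⟨x, hx, rfl⟩ := hT.exists_apply_eq hab.le hD (Ioo_subset_Icc_self hw)
  exact ⟨x, ⟨hx.1.lt_of_ne (ne_of_apply_ne T hw.1.ne), hx.2.lt_of_ne (ne_of_apply_ne T hw.2.ne)⟩,
    rfl⟩

end IsTranslationOff

/-- The points `T ^ n c`, `n ≥ 0`. -/
def forwardOrbit (T : Equiv.Perm (IntervalSum lo hi)) (c : IntervalSum lo hi) :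
    Set (IntervalSum lo hi) :=
  range fun n : ℕ => (T ^ n) c

/-- The nondegenerate interval from `a` to `b` has no point of `S` in its interior. -/
def IsGap (S : Set (IntervalSum lo hi)) (a b : IntervalSum lo hi) : Prop :=
  a < b ∧ Disjoint (Ioo a b) S

theorem IsGap.mono {S : Set (IntervalSum lo hi)} (h : IsGap S a c) (hb : b ∈ Ioc a c) :
    IsGap S a b :=
  ⟨hb.1, h.2.mono_left (Ioo_subset_Ioo_right hb.2)⟩

theorem IsGap.left_unique {S : Set (IntervalSum lo hi)} (ha : IsGap S a c) (hb : IsGap S b c)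
    (haS : a ∈ S) (hbS : b ∈ S) : a = b := by
  have hidx : a.1.1 = b.1.1 := (lt_def.mp ha.1).1.trans (lt_def.mp hb.1).1.symm
  rcases le_or_gt_of_fst_eq hidx with hab | hba
  · by_contra hne
    exact disjoint_left.mp ha.2 ⟨hab.lt_of_ne hne, hb.1⟩ hbS
  · exact absurd haS (disjoint_left.mp hb.2 ⟨hba, ha.1⟩)

theorem IsGap.apply (hT : IsTranslationOff T D) (hgap : IsGap (forwardOrbit T c) a b)
    (hD : Disjoint (Ioc a b) (insert (T⁻¹ c) D)) : IsGap (forwardOrbit T c) (T a) (T b) := by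
  obtain ⟨hc, hD⟩ := disjoint_insert_right.mp hD
  refine ⟨hT.lt hgap.1 hD, disjoint_left.mpr ?_⟩
  rintro w hw ⟨n, hn⟩
  obtain ⟨x, hx, rfl⟩ := hT.Ioo_subset_image hgap.1 hD hw
  cases n with
  | zero => exact hc (Equiv.Perm.inv_eq_iff_eq.mpr hn ▸ Ioo_subset_Ioc_self hx)
  | succ n =>
    refine disjoint_left.mp hgap.2 hx ⟨n, T.injective ?_⟩
    rw [← hn]
    exact (congrArg (· c) (pow_succ' T n)).symm

theorem exists_isGap_pow (hT : IsTranslationOff T D) (hD : IsLocallyFinite D)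
    (hce : IsGap (forwardOrbit T c) c e) (n : ℕ) :
    ∃ b, IsGap (forwardOrbit T c) ((T ^ n) c) b := by
  induction n with
  | zero => exact ⟨e, hce⟩
  | succ n ih =>
    obtain ⟨b, hgap⟩ := ih
    obtain ⟨b', hb', hdisj⟩ := (hD.insert (T⁻¹ c)).exists_mem_Ioc_disjoint hgap.1
    rw [pow_succ']
    exact ⟨T b', (hgap.mono hb').apply hT hdisj⟩

/-- The orbit has only finitely many points with a gap that reaches a discontinuity, so from some
time on `T` moves gaps to gaps of the same length. -/
theorem exists_isGap_pow_of_sub_eq (hT : IsTranslationOff T D) (hD : IsLocallyFinite D)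
    (hF : F.Finite) (hc : c ∈ confined T F)
    (hinj : Function.Injective fun n : ℕ => (T ^ n) c)
    (hce : IsGap (forwardOrbit T c) c e) :
    ∃ m : ℕ, ∃ r > 0, ∀ n, ∃ b, IsGap (forwardOrbit T c) ((T ^ (m + n)) c) b ∧
      b.1.2 - ((T ^ (m + n)) c).1.2 = r := by
  have hcut : {n : ℕ | ∃ d ∈ insert (T⁻¹ c) D, IsGap (forwardOrbit T c) ((T ^ n) c) d}.Finite := by
    refine (((hD.insert (T⁻¹ c)).finite_sep_fst_mem hF).biUnion
      (t := fun d => {n : ℕ | IsGap (forwardOrbit T c) ((T ^ n) c) d}) fun d _ => ?_).subset ?_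
    · exact Set.Subsingleton.finite fun m hm n hn =>
        hinj (hm.left_unique hn ⟨m, rfl⟩ ⟨n, rfl⟩)
    · rintro n ⟨d, hd, hgap⟩
      exact mem_iUnion₂.mpr ⟨d, ⟨hd, hgap.1.le.1 ▸ hc n⟩, hgap⟩
  obtain ⟨m, hm⟩ := hcut.bddAbove
  obtain ⟨b, hb⟩ := exists_isGap_pow hT hD hce (m + 1)
  refine ⟨m + 1, b.1.2 - ((T ^ (m + 1)) c).1.2, sub_pos.mpr (lt_def.mp hb.1).2, fun n => ?_⟩
  induction n with
  | zero => exact ⟨b, hb, rfl⟩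
  | succ n ih =>
    obtain ⟨b', hgap, hlen⟩ := ih
    have hdisj : Disjoint (Ioc ((T ^ (m + 1 + n)) c) b') (insert (T⁻¹ c) D) := by
      refine disjoint_left.mpr fun d hd hdD => ?_
      have := hm ⟨d, hdD, hgap.mono hd⟩
      omega
    refine ⟨T b', ?_, ?_⟩ <;> rw [← add_assoc, pow_succ']
    · exact hgap.apply hT hdisj
    · rw [← hlen]
      exact (hT _ b' hgap.1.le (disjoint_insert_right.mp hdisj).2).2

theorem exists_pow_apply_mem_Ioo (hT : IsTranslationOff T D) (hD : IsLocallyFinite D)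
    (hF : F.Finite) (hc : c ∈ confined T F)
    (hinj : Function.Injective fun n : ℕ => (T ^ n) c) (hce : c < e) :
    ∃ n : ℕ, (T ^ n) c ∈ Ioo c e := by
  by_contra! hno
  have hgap : IsGap (forwardOrbit T c) c e :=
    ⟨hce, disjoint_right.mpr (forall_mem_range.mpr hno)⟩
  obtain ⟨m, r, hr, hm⟩ := exists_isGap_pow_of_sub_eq hT hD hF hc hinj hgap
  obtain ⟨k, l, hkl, hlt⟩ := exists_lt_sub_lt hF
    (hinj.comp (add_right_injective m)) (fun n => hc (m + n)) hr
  obtain ⟨b, hb, hlen⟩ := hm k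
  simp only [Function.comp_apply] at hkl hlt
  refine disjoint_left.mp hb.2 ⟨hkl, lt_def.mpr ⟨?_, by linarith⟩⟩ ⟨m + l, rfl⟩
  exact (lt_def.mp hkl).1.symm.trans (lt_def.mp hb.1).1

/-- Keane's condition for the interval exchange `T`: orbits are infinite,
and none of them runs from a discontinuity of `T⁻¹` (in `D'`) to one of `T` (in `D`). -/
structure IsKeane (T : Equiv.Perm (IntervalSum lo hi))
    (D D' : Set (IntervalSum lo hi)) : Prop where
  isLocallyFinite : IsLocallyFinite D
  isLocallyFinite_inv : IsLocallyFinite D'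
  isTranslationOff : IsTranslationOff T D
  isTranslationOff_inv : IsTranslationOff T⁻¹ D'
  injective_zpow : ∀ c, Function.Injective fun n : ℤ => (T ^ n) c
  not_connected : ∀ c (m n : ℕ), (T ^ m) c ∈ D → (T⁻¹ ^ n) c ∉ D'

namespace IsKeane

theorem inv (h : IsKeane T D D') : IsKeane T⁻¹ D' D where
  isLocallyFinite := h.isLocallyFinite_inv
  isLocallyFinite_inv := h.isLocallyFinite
  isTranslationOff := h.isTranslationOff_inv
  isTranslationOff_inv := h.isTranslationOff
  injective_zpow c := by
    simpa only [inv_zpow', Function.comp_def] using (h.injective_zpow c).comp neg_injective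
  not_connected c m n hm hn := h.not_connected c n m hn hm

theorem injective_pow (h : IsKeane T D D') (c : IntervalSum lo hi) :
    Function.Injective fun n : ℕ => (T ^ n) c := by
  simpa only [zpow_natCast, Function.comp_def] using (h.injective_zpow c).comp Nat.cast_injective

theorem inv_apply_mem_confined (h : IsKeane T D D') (hF : F.Finite) (hc : c ∈ confined T F) :
    T⁻¹ c ∈ confined T F := by
  obtain ⟨e, hce⟩ := exists_gt c
  obtain ⟨b, hb, hdisj⟩ := h.isLocallyFinite_inv.exists_mem_Ioc_disjoint hce
  obtain ⟨n, hn⟩ := exists_pow_apply_mem_Ioo h.isTranslationOff h.isLocallyFinite hF hc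
    (h.injective_pow c) hb.1
  cases n with
  | zero => exact absurd hn.1 (lt_irrefl c)
  | succ n =>
    have hle := (h.isTranslationOff_inv c _ hn.1.le
      (hdisj.mono_left (Ioc_subset_Ioc_right hn.2.le))).1
    rw [pow_succ', Equiv.Perm.mul_apply, Equiv.Perm.inv_def,
      Equiv.symm_apply_apply] at hle
    refine mem_confined_iff.mpr ⟨hle.1 ▸ hc n, ?_⟩
    rwa [Equiv.Perm.inv_def, Equiv.apply_symm_apply]

theorem confined_inv (h : IsKeane T D D') (hF : F.Finite) : confined T⁻¹ F = confined T F := by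
  have hsub : ∀ {T : Equiv.Perm (IntervalSum lo hi)} {D D'}, IsKeane T D D' →
      confined T F ⊆ confined T⁻¹ F := by
    intro T D D' h c hc n
    have hn : (T⁻¹ ^ n) c ∈ confined T F := by
      induction n with
      | zero => exact hc
      | succ n ih =>
        rw [pow_succ', Equiv.Perm.mul_apply]
        exact h.inv_apply_mem_confined hF ih
    exact hn 0
  exact (inv_inv T ▸ hsub h.inv).antisymm (hsub h)

end IsKeane

theorem exists_disjoint_Ico_confined (hT : IsTranslationOff T D) (hD : IsLocallyFinite D)
    (hc : c ∉ confined T F) (hce : c < e) : ∃ b ∈ Ioc c e, Disjoint (Ico c b) (confined T F) := by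
  obtain ⟨n, hn⟩ : ∃ n : ℕ, ((T ^ n) c).1.1 ∉ F := not_forall.mp hc
  induction n generalizing c e with
  | zero =>
    exact ⟨e, right_mem_Ioc.mpr hce, disjoint_left.mpr fun x hx hxF =>
      hn (hx.1.1 ▸ fst_mem_of_mem_confined hxF)⟩
  | succ n ih =>
    by_cases hcF : c.1.1 ∈ F
    · obtain ⟨e', he', hdisj⟩ := hD.exists_mem_Ioc_disjoint hce
      obtain ⟨b, hb, hbT⟩ := ih (fun h => hc (mem_confined_iff.mpr ⟨hcF, h⟩))
        (hT.lt he'.1 hdisj) hn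
      obtain ⟨x, hx, rfl⟩ := hT.exists_apply_eq he'.1.le hdisj (Ioc_subset_Icc_self hb)
      refine ⟨x, ⟨hx.1.lt_of_ne (ne_of_apply_ne T hb.1.ne), hx.2.trans he'.2⟩,
        disjoint_left.mpr fun y hy hyF => disjoint_left.mp hbT ⟨?_, ?_⟩ (mem_confined_iff.mp hyF).2⟩
      · exact (hT c y hy.1 (hdisj.mono_left (Ioc_subset_Ioc_right (hy.2.le.trans hx.2)))).1
      · exact hT.lt hy.2 (hdisj.mono_left (Ioc_subset_Ioc hy.1 hx.2))
    · exact ⟨e, right_mem_Ioc.mpr hce, disjoint_left.mpr fun x hx hxF =>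
      hcF (hx.1.1 ▸ fst_mem_of_mem_confined hxF)⟩

theorem exists_disjoint_Ioc_confined (hT : IsTranslationOff T D) (hD : IsLocallyFinite D)
    (hc : c ∉ confined T F) (hcD : ∀ n : ℕ, (T ^ n) c ∉ D) (hac : a < c) :
    ∃ b ∈ Ico a c, Disjoint (Ioc b c) (confined T F) := by
  obtain ⟨n, hn⟩ : ∃ n : ℕ, ((T ^ n) c).1.1 ∉ F := not_forall.mp hc
  induction n generalizing a c with
  | zero =>
    exact ⟨a, left_mem_Ico.mpr hac, disjoint_left.mpr fun x hx hxF =>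
      hn (hx.2.1 ▸ fst_mem_of_mem_confined hxF)⟩
  | succ n ih =>
    by_cases hcF : c.1.1 ∈ F
    · obtain ⟨a', ha', hdisj⟩ := hD.exists_mem_Ico_disjoint hac (hcD 0)
      obtain ⟨b, hb, hbT⟩ := ih (fun h => hc (mem_confined_iff.mpr ⟨hcF, h⟩))
        (fun n => hcD (n + 1)) (hT.lt ha'.2 hdisj) hn
      obtain ⟨x, hx, rfl⟩ := hT.exists_apply_eq ha'.2.le hdisj (Ico_subset_Icc_self hb)
      refine ⟨x, ⟨ha'.1.trans hx.1, hx.2.lt_of_ne (ne_of_apply_ne T hb.2.ne)⟩,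
        disjoint_left.mpr fun y hy hyF => disjoint_left.mp hbT ⟨?_, ?_⟩ (mem_confined_iff.mp hyF).2⟩
      · exact hT.lt hy.1 (hdisj.mono_left (Ioc_subset_Ioc hx.1 hy.2))
      · exact (hT y c hy.2 (hdisj.mono_left (Ioc_subset_Ioc_left (hx.1.trans hy.1.le)))).1
    · exact ⟨a, left_mem_Ico.mpr hac, disjoint_left.mpr fun x hx hxF =>
      hcF (hx.2.1 ▸ fst_mem_of_mem_confined hxF)⟩

namespace IsKeane

theorem exists_disjoint_Ioc_confined (h : IsKeane T D D') (hF : F.Finite) (hc : c ∉ confined T F)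
    (hac : a < c) : ∃ b ∈ Ico a c, Disjoint (Ioc b c) (confined T F) := by
  by_cases hcD : ∀ n : ℕ, (T ^ n) c ∉ D
  · exact IntervalSum.exists_disjoint_Ioc_confined h.isTranslationOff h.isLocallyFinite hc hcD hac
  · obtain ⟨m, hm⟩ := by simpa only [not_forall, not_not] using hcD
    rw [← h.confined_inv hF] at hc ⊢
    exact IntervalSum.exists_disjoint_Ioc_confined h.isTranslationOff_inv h.isLocallyFinite_inv hc
      (h.not_connected c m · hm) hac

theorem isUpperSet_confined (h : IsKeane T D D') (hF : F.Finite) : IsUpperSet (confined T F) := by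
  intro a y hay ha
  obtain ⟨s, hs, hlub⟩ := exists_isLUB (s := confined T F ∩ Icc a y) inter_subset_right
    ⟨a, ha, left_mem_Icc.mpr hay⟩
  have hsW : s ∈ confined T F := by
    by_contra hsW
    have has : a < s := hs.1.lt_of_ne fun heq => hsW (heq ▸ ha)
    obtain ⟨b, hb, hdisj⟩ := h.exists_disjoint_Ioc_confined hF hsW has
    refine hb.2.not_ge (hlub.2 fun x hx => ?_)
    have hxb := le_or_gt_of_fst_eq (hx.2.1.1.symm.trans hb.1.1)
    exact hxb.resolve_right fun hbx => disjoint_left.mp hdisj ⟨hbx, hlub.1 hx⟩ hx.1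
  rcases hs.2.eq_or_lt with rfl | hsy
  · exact hsW
  · obtain ⟨n, hn⟩ := exists_pow_apply_mem_Ioo h.isTranslationOff h.isLocallyFinite hF
      hsW (h.injective_pow s) hsy
    exact absurd (hlub.1 ⟨pow_apply_mem_confined hsW n, hs.1.trans hn.1.le, hn.2.le⟩) hn.1.not_ge

end IsKeane

/-- `b` is a lower end of `S` inside its interval: the least point of `S` there, but not the least
point of the interval. -/
def IsLowerEnd (S : Set (IntervalSum lo hi)) (b : IntervalSum lo hi) : Prop :=
  b ∈ S ∧ (∃ a, a < b) ∧ ∀ a < b, a ∉ S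

theorem finite_setOf_isLowerEnd_confined (hF : F.Finite) :
    {b | IsLowerEnd (confined T F) b}.Finite := by
  refine Set.Finite.of_finite_image (f := fun b => b.1.1) (hF.subset ?_) ?_
  · rintro _ ⟨b, hb, rfl⟩
    exact fst_mem_of_mem_confined hb.1
  · intro a ha b hb hab
    rcases le_or_gt_of_fst_eq hab with hle | hlt
    · exact hle.eq_of_not_lt fun hlt => hb.2.2 a hlt ha.1
    · exact absurd hb.1 (ha.2.2 b hlt)

namespace IsKeane

theorem isLowerEnd_apply (h : IsKeane T D D') (hF : F.Finite)
    (hb : IsLowerEnd (confined T F) b) (hbD : b ∉ D) : IsLowerEnd (confined T F) (T b) := by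
  obtain ⟨hbW, ⟨a, hab⟩, hlow⟩ := hb
  obtain ⟨a', ha', hdisj⟩ := h.isLocallyFinite.exists_mem_Ico_disjoint hab hbD
  have hlt := h.isTranslationOff.lt ha'.2 hdisj
  have hTlow : ∀ x < b, T x ∉ confined T F := fun x hx hTx =>
    hlow x hx (by simpa using h.inv_apply_mem_confined hF hTx)
  refine ⟨(mem_confined_iff.mp hbW).2, ⟨T a', hlt⟩, fun w hw hwW => ?_⟩
  rcases le_or_gt_of_fst_eq (hw.le.1.trans hlt.le.1.symm) with hwa | haw
  · exact hTlow a' ha'.2 (h.isUpperSet_confined hF hwa hwW)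
  · obtain ⟨x, hx, rfl⟩ := h.isTranslationOff.Ioo_subset_image ha'.2 hdisj ⟨haw, hw⟩
    exact hTlow x hx.2 hwW

theorem exists_pow_apply_mem_of_isLowerEnd (h : IsKeane T D D') (hF : F.Finite)
    (hb : IsLowerEnd (confined T F) b) : ∃ n : ℕ, (T ^ n) b ∈ D := by
  by_contra! hbD
  have hend : ∀ n : ℕ, IsLowerEnd (confined T F) ((T ^ n) b) := by
    intro n
    induction n with
    | zero => exact hb
    | succ n ih =>
      rw [pow_succ', Equiv.Perm.mul_apply]
      exact h.isLowerEnd_apply hF ih (hbD n)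
  exact infinite_range_of_injective (h.injective_pow b)
    ((finite_setOf_isLowerEnd_confined hF).subset (range_subset_iff.mpr hend))

theorem not_isLowerEnd_confined (h : IsKeane T D D') (hF : F.Finite) (b : IntervalSum lo hi) :
    ¬ IsLowerEnd (confined T F) b := by
  intro hb
  obtain ⟨m, hm⟩ := h.exists_pow_apply_mem_of_isLowerEnd hF hb
  obtain ⟨n, hn⟩ := h.inv.exists_pow_apply_mem_of_isLowerEnd hF ((h.confined_inv hF).symm ▸ hb)
  exact h.not_connected b m n hm hn

theorem isLowerSet_confined (h : IsKeane T D D') (hF : F.Finite) : IsLowerSet (confined T F) := by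
  intro x y hyx hx
  by_contra hy
  obtain ⟨s, hs, hglb⟩ := exists_isGLB (s := confined T F ∩ Icc y x) inter_subset_right
    ⟨x, hx, right_mem_Icc.mpr hyx⟩
  have hsW : s ∈ confined T F := by
    by_contra hsW
    have hsx : s < x := hs.2.lt_of_ne fun heq => hsW (heq ▸ hx)
    obtain ⟨b, hb, hdisj⟩ :=
      exists_disjoint_Ico_confined h.isTranslationOff h.isLocallyFinite hsW hsx
    refine hb.1.not_ge (hglb.2 fun z hz => ?_)
    have hbz := le_or_gt_of_fst_eq (hb.2.1.trans hz.2.2.1.symm)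
    exact hbz.resolve_right fun hzb => disjoint_left.mp hdisj ⟨hglb.1 hz, hzb⟩ hz.1
  have hys : y < s := hs.1.lt_of_ne fun h => hy (h ▸ hsW)
  refine h.not_isLowerEnd_confined hF s ⟨hsW, ⟨y, hys⟩, fun a has ha => ?_⟩
  rcases le_or_gt_of_fst_eq (has.le.1.trans hys.le.1.symm) with hay | hya
  · exact hy (h.isUpperSet_confined hF hay ha)
  · exact has.not_ge (hglb.1 ⟨ha, hya.le, has.le.trans hs.2⟩)

theorem mem_confined_of_fst_eq (h : IsKeane T D D') (hF : F.Finite) (hc : c ∈ confined T F)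
    (hx : a.1.1 = c.1.1) : a ∈ confined T F := by
  rcases le_or_gt_of_fst_eq hx with hac | hca
  · exact h.isLowerSet_confined hF hac hc
  · exact h.isUpperSet_confined hF hca.le hc

end IsKeane

end IntervalSum

/-! ### The billiard as an interval exchange -/

namespace StepBilliard

variable (B : StepBilliard)

/-- The additive group generated by the heights of the table. -/
def heightGroup : AddSubgroup ℝ :=
  (Finsupp.linearCombination ℤ B.p).toAddMonoidHom.range

theorem countable_heightGroup : (B.heightGroup : Set ℝ).Countable :=
  countable_range (Finsupp.linearCombination ℤ B.p)

theorem height_mem_heightGroup (k : ℤ) : B.height k ∈ B.heightGroup := by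
  rcases k with n | n <;> exact ⟨Finsupp.single n 1, by simp [height]⟩

theorem wrap_sub_mem (k : ℤ) (y : ℝ) : B.wrap k y - y ∈ B.heightGroup := by
  have hk : 2 * B.height k ∈ B.heightGroup := by
    rw [two_mul]
    exact add_mem (B.height_mem_heightGroup k) (B.height_mem_heightGroup k)
  rw [wrap, toIcoMod, sub_sub_cancel_left]
  exact neg_mem (zsmul_mem hk _)

/-- The left edges of the columns, as the phase space of an interval exchange: it has the same
elements as `LeftEdge`, and the order of `IntervalSum`. -/
abbrev Edges : Type := IntervalSum (-B.height) B.height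

/-- The motion `cross` from edge to edge, as an interval exchange. -/
def edgeExchange (θ : ℝ) : Equiv.Perm B.Edges := B.cross θ

theorem edgeExchange_zpow_sub_mem (θ : ℝ) (i : ℤ) (c : B.Edges) :
    ((B.edgeExchange θ ^ i) c).1.2 - c.1.2 - i * Real.tan θ ∈ B.heightGroup := by
  have step (i : ℤ) : ((B.edgeExchange θ ^ (i + 1)) c).1.2 -
      (((B.edgeExchange θ ^ i) c).1.2 + Real.tan θ) ∈ B.heightGroup := by
    rw [add_comm i, zpow_one_add]
    exact B.wrap_sub_mem _ _
  induction i using Int.induction_on with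
  | zero => simp
  | succ i ih =>
    convert add_mem ih (step i) using 1
    push_cast
    ring
  | pred i ih =>
    convert sub_mem ih (step (-i - 1)) using 1
    rw [sub_add_cancel]
    push_cast
    ring

/-- No nonzero multiple of the slope is a combination of heights, so a trajectory neither closes up
nor joins two corners. -/
def IsFreeDirection (θ : ℝ) : Prop :=
  ∀ m : ℤ, m ≠ 0 → m * Real.tan θ ∉ B.heightGroup

variable {B} {θ : ℝ}

theorem IsFreeDirection.eq_of_zpow_sub_mem (hθ : B.IsFreeDirection θ) {c : B.Edges} {m n : ℤ}
    (h : ((B.edgeExchange θ ^ m) c).1.2 - ((B.edgeExchange θ ^ n) c).1.2 ∈ B.heightGroup) :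
    m = n := by
  by_contra hmn
  refine hθ (m - n) (sub_ne_zero.mpr hmn) ?_
  convert add_mem (sub_mem h (B.edgeExchange_zpow_sub_mem θ m c))
    (B.edgeExchange_zpow_sub_mem θ n c) using 1
  push_cast
  ring

theorem wrap_eq_of_mem {k : ℤ} {y y' : ℝ} (h : y' ∈ B.fiber k) (m : ℤ)
    (hm : y = y' + m * (2 * B.height k)) : B.wrap k y = y' := by
  rw [← B.wrap_of_mem h, wrap, wrap, toIcoMod_eq_toIcoMod]
  exact ⟨-m, by rw [hm, zsmul_eq_mul]; push_cast; ring⟩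

theorem wrap_height (k : ℤ) : B.wrap k (B.height k) = -B.height k :=
  wrap_eq_of_mem (left_mem_Ico.mpr (neg_lt_self (B.height_pos k))) 1 (by push_cast; ring)

theorem wrap_add_of_forall_ne {k : ℤ} {y t : ℝ} (ht : 0 ≤ t)
    (h : ∀ s ∈ Ioc 0 t, B.wrap k (y + s) ≠ -B.height k) : B.wrap k (y + t) = B.wrap k y + t := by
  have hw := B.wrap_mem k y
  have hlt : B.wrap k y + t < B.height k := by
    by_contra! hle
    refine h (B.height k - B.wrap k y) ⟨sub_pos.mpr hw.2, by linarith⟩ ?_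
    rw [← wrap_wrap_add, add_sub_cancel, wrap_height]
  rw [← wrap_wrap_add, B.wrap_of_mem ⟨by linarith [hw.1], hlt⟩]

theorem mem_fiber_iff_of_forall_ne {k : ℤ} {y y' : ℝ} (hy : y ≤ y')
    (h : ∀ x ∈ Ioc y y', |x| ≠ B.height k) : y ∈ B.fiber k ↔ y' ∈ B.fiber k := by
  have hk := B.height_pos k
  constructor
  · intro hm
    refine ⟨hm.1.trans hy, not_le.mp fun hle => h _ ⟨hm.2, hle⟩ (abs_of_pos hk)⟩
  · intro hm
    refine ⟨not_lt.mp fun hlt => h _ ⟨hlt, hm.1⟩ ?_, hy.trans_lt hm.2⟩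
    rw [abs_neg, abs_of_pos hk]

theorem edgeExchange_fst_of_mem {c : B.Edges} (h : (B.edgeExchange θ c).1.2 ∈ B.fiber (c.1.1 + 1)) :
    (B.edgeExchange θ c).1.1 = c.1.1 + 1 :=
  if_pos h

theorem edgeExchange_fst_of_notMem {c : B.Edges}
    (h : (B.edgeExchange θ c).1.2 ∉ B.fiber (c.1.1 + 1)) :
    (B.edgeExchange θ c).1.1 = -(c.1.1 + 1) :=
  if_neg h

theorem edgeExchange_inv_fst_of_mem {c : B.Edges} (h : c.1.2 ∈ B.fiber (c.1.1 - 1)) :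
    ((B.edgeExchange θ)⁻¹ c).1.1 = c.1.1 - 1 :=
  congrArg (· - 1) (if_pos h)

theorem edgeExchange_inv_fst_of_notMem {c : B.Edges} (h : c.1.2 ∉ B.fiber (c.1.1 - 1)) :
    ((B.edgeExchange θ)⁻¹ c).1.1 = -c.1.1 - 1 :=
  congrArg (· - 1) (if_neg h)

theorem edgeExchange_snd (c : B.Edges) :
    (B.edgeExchange θ c).1.2 = B.wrap c.1.1 (c.1.2 + Real.tan θ) :=
  rfl

theorem edgeExchange_inv_snd (c : B.Edges) :
    ((B.edgeExchange θ)⁻¹ c).1.2 = B.wrap ((B.edgeExchange θ)⁻¹ c).1.1 (c.1.2 - Real.tan θ) :=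
  rfl

variable (B) in
/-- The points of the left edges that are level with a corner of the table, namely with an end of
the left edge itself or of the right edge at the same abscissa. -/
def cornerLevels : Set B.Edges :=
  {c | |c.1.2| = B.height c.1.1 ∨ |c.1.2| = B.height (c.1.1 - 1)}

theorem mem_heightGroup_of_mem_cornerLevels {c : B.Edges} (hc : c ∈ B.cornerLevels) :
    c.1.2 ∈ B.heightGroup := by
  rw [← abs_mem_iff]
  rcases hc with hc | hc <;> exact hc ▸ B.height_mem_heightGroup _

theorem edgeExchange_mem_cornerLevels_iff {c : B.Edges} :
    B.edgeExchange θ c ∈ B.cornerLevels ↔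
      |(B.edgeExchange θ c).1.2| = B.height c.1.1 ∨
        |(B.edgeExchange θ c).1.2| = B.height (c.1.1 + 1) := by
  by_cases h : (B.edgeExchange θ c).1.2 ∈ B.fiber (c.1.1 + 1)
  · rw [cornerLevels, mem_ofPred, edgeExchange_fst_of_mem h, add_sub_cancel_right, or_comm]
  · rw [cornerLevels, mem_ofPred, edgeExchange_fst_of_notMem h, height_neg, add_sub_cancel_right,
      ← neg_add', height_neg, add_sub_cancel_right]

variable (B) in
theorem isLocallyFinite_cornerLevels :
    IntervalSum.IsLocallyFinite B.cornerLevels := by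
  intro k
  have hfin (h : ℝ) : {y : ℝ | |y| = h}.Finite :=
    (toFinite {h, -h}).subset fun y hy => eq_or_eq_neg_of_abs_eq hy
  refine Set.Finite.of_finite_image (f := fun c : B.Edges => c.1.2)
    (((hfin (B.height k)).union (hfin (B.height (k - 1)))).subset ?_) ?_
  · rintro _ ⟨c, ⟨hc, rfl⟩, rfl⟩
    exact hc
  · rintro a ⟨-, ha⟩ b ⟨-, hb⟩ hab
    exact Subtype.ext (Prod.ext (ha.trans hb.symm) hab)

theorem isLocallyFinite_preimage_edgeExchange_cornerLevels :
    IntervalSum.IsLocallyFinite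
      {c | B.edgeExchange θ c ∈ B.cornerLevels} := by
  intro k
  have hfin := B.isLocallyFinite_cornerLevels.finite_sep_fst_mem (toFinite {k + 1, -(k + 1)})
  refine (hfin.preimage ((B.edgeExchange θ).injective.injOn)).subset ?_
  rintro c ⟨hc, rfl⟩
  refine ⟨hc, ?_⟩
  by_cases h : (B.edgeExchange θ c).1.2 ∈ B.fiber (c.1.1 + 1)
  · exact Or.inl (edgeExchange_fst_of_mem h)
  · exact Or.inr (edgeExchange_fst_of_notMem h)

theorem isLocallyFinite_preimage_edgeExchange_inv_cornerLevels :
    IntervalSum.IsLocallyFinite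
      {c | (B.edgeExchange θ)⁻¹ c ∈ B.cornerLevels} := by
  intro k
  have hfin := B.isLocallyFinite_cornerLevels.finite_sep_fst_mem (toFinite {k - 1, -k - 1})
  refine (hfin.preimage (((B.edgeExchange θ)⁻¹).injective.injOn)).subset ?_
  rintro c ⟨hc, rfl⟩
  refine ⟨hc, ?_⟩
  by_cases h : c.1.2 ∈ B.fiber (c.1.1 - 1)
  · exact Or.inl (edgeExchange_inv_fst_of_mem h)
  · exact Or.inr (edgeExchange_inv_fst_of_notMem h)

theorem isTranslationOff_edgeExchange :
    IntervalSum.IsTranslationOff (B.edgeExchange θ)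
      {c | B.edgeExchange θ c ∈ B.cornerLevels} := by
  intro a b hab hdisj
  have hoff : ∀ x ∈ Ioc a b, |(B.edgeExchange θ x).1.2| ≠ B.height a.1.1 ∧
      |(B.edgeExchange θ x).1.2| ≠ B.height (a.1.1 + 1) := by
    intro x hx
    rw [hx.1.le.1, ← not_or, ← edgeExchange_mem_cornerLevels_iff]
    exact disjoint_left.mp hdisj hx
  have hsnd : ∀ x ∈ Icc a b,
      (B.edgeExchange θ x).1.2 = (B.edgeExchange θ a).1.2 + (x.1.2 - a.1.2) := by
    intro x hx
    have hwrap := wrap_add_of_forall_ne (B := B) (k := a.1.1) (y := a.1.2 + Real.tan θ)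
      (sub_nonneg.mpr hx.1.2) fun s hs => ?_
    · rw [edgeExchange_snd, edgeExchange_snd, ← hwrap, hx.1.1]
      ring_nf
    · obtain ⟨z, hz, hzs⟩ := IntervalSum.exists_mem_Ioc hx.1 (y := a.1.2 + s)
        ⟨by linarith [hs.1], by linarith [hs.2]⟩
      intro h
      refine (hoff z ⟨hz.1, hz.2.trans hx.2⟩).1 ?_
      rw [edgeExchange_snd, ← hz.1.le.1, hzs, add_right_comm, h, abs_neg,
        abs_of_pos (B.height_pos _)]
  have hb := hsnd b (right_mem_Icc.mpr hab)
  have hle : (B.edgeExchange θ a).1.2 ≤ (B.edgeExchange θ b).1.2 := by linarith [hab.2]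
  have hmem : (B.edgeExchange θ a).1.2 ∈ B.fiber (a.1.1 + 1) ↔
      (B.edgeExchange θ b).1.2 ∈ B.fiber (a.1.1 + 1) := by
    refine mem_fiber_iff_of_forall_ne hle fun w hw => ?_
    obtain ⟨x, hx, hxw⟩ := IntervalSum.exists_mem_Ioc hab
      (y := a.1.2 + (w - (B.edgeExchange θ a).1.2)) ⟨by linarith [hw.1], by linarith [hw.2]⟩
    convert (hoff x hx).2 using 2
    rw [hsnd x (Ioc_subset_Icc_self hx)]
    linarith
  refine ⟨⟨?_, hle⟩, by linarith⟩
  by_cases h : (B.edgeExchange θ a).1.2 ∈ B.fiber (a.1.1 + 1)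
  · rw [edgeExchange_fst_of_mem h, edgeExchange_fst_of_mem (hab.1 ▸ hmem.mp h), hab.1]
  · rw [edgeExchange_fst_of_notMem h, edgeExchange_fst_of_notMem (hab.1 ▸ mt hmem.mpr h), hab.1]

theorem isTranslationOff_edgeExchange_inv :
    IntervalSum.IsTranslationOff (B.edgeExchange θ)⁻¹
      (B.cornerLevels ∪ {c | (B.edgeExchange θ)⁻¹ c ∈ B.cornerLevels}) := by
  intro a b hab hdisj
  obtain ⟨hlevel, hdisj⟩ := disjoint_union_right.mp hdisj
  have hfst : ∀ x ∈ Icc a b, ((B.edgeExchange θ)⁻¹ x).1.1 = ((B.edgeExchange θ)⁻¹ a).1.1 := by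
    intro x hx
    have hmem : a.1.2 ∈ B.fiber (a.1.1 - 1) ↔ x.1.2 ∈ B.fiber (a.1.1 - 1) := by
      refine mem_fiber_iff_of_forall_ne hx.1.2 fun w hw => ?_
      obtain ⟨z, hz, rfl⟩ := IntervalSum.exists_mem_Ioc hx.1 hw
      rw [hz.1.le.1]
      exact fun h => disjoint_left.mp hlevel ⟨hz.1, hz.2.trans hx.2⟩ (Or.inr h)
    by_cases h : a.1.2 ∈ B.fiber (a.1.1 - 1)
    · rw [edgeExchange_inv_fst_of_mem h, edgeExchange_inv_fst_of_mem (hx.1.1 ▸ hmem.mp h), hx.1.1]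
    · rw [edgeExchange_inv_fst_of_notMem h, edgeExchange_inv_fst_of_notMem (hx.1.1 ▸ mt hmem.mpr h),
        hx.1.1]
  have hb := hfst b (right_mem_Icc.mpr hab)
  have hsnd := wrap_add_of_forall_ne (B := B) (k := ((B.edgeExchange θ)⁻¹ a).1.1)
    (y := a.1.2 - Real.tan θ) (sub_nonneg.mpr hab.2) fun s hs h => ?_
  · have hlen : ((B.edgeExchange θ)⁻¹ b).1.2 = ((B.edgeExchange θ)⁻¹ a).1.2 + (b.1.2 - a.1.2) := by
      rw [edgeExchange_inv_snd b, hb, edgeExchange_inv_snd a, ← hsnd]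
      congr 1
      ring
    exact ⟨⟨hb.symm, by linarith [hab.2]⟩, by linarith⟩
  · obtain ⟨z, hz, hzs⟩ := IntervalSum.exists_mem_Ioc hab (y := a.1.2 + s)
      ⟨by linarith [hs.1], by linarith [hs.2]⟩
    refine disjoint_left.mp hdisj hz (Or.inl ?_)
    rw [edgeExchange_inv_snd, hfst z (Ioc_subset_Icc_self hz), hzs, add_sub_right_comm, h, abs_neg,
      abs_of_pos (B.height_pos _)]

theorem IsFreeDirection.isKeane_edgeExchange (hθ : B.IsFreeDirection θ) :
    IntervalSum.IsKeane (B.edgeExchange θ)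
      {c | B.edgeExchange θ c ∈ B.cornerLevels}
      (B.cornerLevels ∪ {c | (B.edgeExchange θ)⁻¹ c ∈ B.cornerLevels}) where
  isLocallyFinite := isLocallyFinite_preimage_edgeExchange_cornerLevels
  isLocallyFinite_inv := B.isLocallyFinite_cornerLevels.union
    isLocallyFinite_preimage_edgeExchange_inv_cornerLevels
  isTranslationOff := isTranslationOff_edgeExchange
  isTranslationOff_inv := isTranslationOff_edgeExchange_inv
  injective_zpow c m n hmn := hθ.eq_of_zpow_sub_mem (c := c) <| by
    rw [show (B.edgeExchange θ ^ m) c = (B.edgeExchange θ ^ n) c from hmn, sub_self]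
    exact zero_mem _
  not_connected c m n hm hn := by
    have hne : ∀ i : ℕ, (B.edgeExchange θ ^ (-(i : ℤ))) c ∉ B.cornerLevels := by
      intro i hi
      have hm' : (B.edgeExchange θ ^ (m + 1 : ℤ)) c ∈ B.cornerLevels := by
        rw [add_comm, zpow_one_add]
        exact hm
      have := hθ.eq_of_zpow_sub_mem (sub_mem (mem_heightGroup_of_mem_cornerLevels hm')
        (mem_heightGroup_of_mem_cornerLevels hi))
      omega
    rcases hn with hn | hn
    · exact hne n (by rwa [zpow_neg, zpow_natCast, ← inv_pow])
    · refine hne (n + 1) ?_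
      rwa [zpow_neg, zpow_natCast, ← inv_pow, pow_succ']

variable (B) in
/-- The midpoint of the left edge of column `k`. -/
def axisPoint (k : ℤ) : B.Edges :=
  ⟨(k, 0), neg_nonpos.mpr (B.height_pos k).le, B.height_pos k⟩

theorem edgeExchange_inv_axisPoint_fst (k : ℤ) :
    ((B.edgeExchange θ)⁻¹ (B.axisPoint (k + 1))).1.1 = k := by
  have hmem : (0 : ℝ) ∈ B.fiber (k + 1 - 1) := (B.axisPoint (k + 1 - 1)).2
  exact (edgeExchange_inv_fst_of_mem hmem).trans (add_sub_cancel_right k 1)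

/-- A column that contains a confined point is confined as a whole, and then so is the next column,
which can be entered from it. -/
theorem IsFreeDirection.notMem_confined (hθ : B.IsFreeDirection θ) {F : Set ℤ} (hF : F.Finite)
    (c : B.Edges) : c ∉ IntervalSum.confined (B.edgeExchange θ) F := by
  intro hc
  have hcols : ((fun x : B.Edges => x.1.1) '' IntervalSum.confined (B.edgeExchange θ) F).Finite :=
    hF.subset (image_subset_iff.mpr fun x hx => IntervalSum.fst_mem_of_mem_confined hx)
  obtain ⟨_, ⟨x, hx, rfl⟩, hmax⟩ := exists_max_image _ id hcols ⟨_, c, hc, rfl⟩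
  have hnext : B.axisPoint (x.1.1 + 1) ∈ IntervalSum.confined (B.edgeExchange θ) F := by
    have hprev := hθ.isKeane_edgeExchange.mem_confined_of_fst_eq hF hx
      (edgeExchange_inv_axisPoint_fst (θ := θ) x.1.1)
    simpa using (IntervalSum.mem_confined_iff.mp hprev).2
  exact (lt_add_one x.1.1).not_ge (hmax _ ⟨_, hnext, rfl⟩)

namespace Surface

/-- The point of the left edge of its column from which the trajectory of `z` arrives. -/
def start (θ : ℝ) (z : B.Surface) : B.Edges :=
  ⟨(⌊z.1.1⌋, B.wrap ⌊z.1.1⌋ (z.1.2 - Int.fract z.1.1 * Real.tan θ)), B.wrap_mem _ _⟩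

/-- A point of a left edge, as a point of the surface. -/
def ofEdge (c : B.Edges) : B.Surface :=
  ⟨((c.1.1 : ℝ), c.1.2), by
    rw [Int.floor_intCast]
    exact c.2⟩

theorem start_ofEdge (c : B.Edges) : (ofEdge c).start θ = c := by
  refine Subtype.ext (Prod.ext (Int.floor_intCast c.1.1) ?_)
  simp only [start, ofEdge, Int.floor_intCast, Int.fract_intCast, zero_mul, sub_zero]
  exact B.wrap_of_mem c.2

/-- The time at which the trajectory of `z`, if it moves to the right, enters the `i`-th column
after that of `z`. -/
def edgeTime (θ : ℝ) (z : B.Surface) (i : ℤ) : ℝ :=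
  (i - Int.fract z.1.1) / Real.cos θ

end Surface

theorem coe_flow {t : ℝ} {z : B.Surface} {i : ℤ} {r : ℝ} (hr : r ∈ Ico (0 : ℝ) 1)
    (h : Int.fract z.1.1 + t * Real.cos θ = i + r) :
    (B.flow θ t z).1 = ((((B.edgeExchange θ ^ i) (z.start θ)).1.1 : ℝ) + r,
      B.wrap ((B.edgeExchange θ ^ i) (z.start θ)).1.1
        (((B.edgeExchange θ ^ i) (z.start θ)).1.2 + r * Real.tan θ)) := by
  have hfloor : ⌊Int.fract z.1.1 + t * Real.cos θ⌋ = i :=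
    Int.floor_eq_iff.mpr ⟨by linarith [hr.1], by linarith [hr.2]⟩
  have hfract : Int.fract (Int.fract z.1.1 + t * Real.cos θ) = r := by
    rw [Int.fract, hfloor, h, add_sub_cancel_left]
  simp only [flow, hfloor, hfract]
  rfl

theorem position_flow_edgeTime_fst (hcos : Real.cos θ ≠ 0) (z : B.Surface) (i : ℤ) :
    (B.flow θ (z.edgeTime θ i) z).position.1 =
      |(((B.edgeExchange θ ^ i) (z.start θ)).1.1 : ℝ)| := by
  have htime : Int.fract z.1.1 + z.edgeTime θ i * Real.cos θ = i + 0 := by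
    rw [Surface.edgeTime, div_mul_cancel₀ _ hcos, add_sub_cancel, add_zero]
  rw [Surface.position, coe_flow (left_mem_Ico.mpr one_pos) htime, add_zero]

theorem flow_eq_self_iff {t : ℝ} {z : B.Surface} :
    B.flow θ t z = z ↔
      ∃ m : ℤ, m = t * Real.cos θ ∧ (B.edgeExchange θ ^ m) (z.start θ) = z.start θ := by
  constructor
  · intro hz
    set u := Int.fract z.1.1 + t * Real.cos θ
    set c := (B.edgeExchange θ ^ ⌊u⌋) (z.start θ)
    have hflow : z.1 = ((c.1.1 : ℝ) + Int.fract u,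
        B.wrap c.1.1 (c.1.2 + Int.fract u * Real.tan θ)) :=
      (congrArg Subtype.val hz).symm.trans <|
        coe_flow ⟨Int.fract_nonneg u, Int.fract_lt_one u⟩ (Int.floor_add_fract u).symm
    have hfloor : ⌊z.1.1⌋ = c.1.1 := by
      rw [hflow, Int.floor_intCast_add, Int.floor_fract, add_zero]
    have hfract : Int.fract z.1.1 = Int.fract u := by
      rw [hflow, Int.fract_intCast_add, Int.fract_fract]
    refine ⟨⌊u⌋, by linarith [Int.floor_add_fract u], Subtype.ext (Prod.ext hfloor.symm ?_)⟩
    change c.1.2 = B.wrap ⌊z.1.1⌋ (z.1.2 - Int.fract z.1.1 * Real.tan θ)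
    rw [hfloor, hfract, hflow, sub_eq_add_neg, wrap_wrap_add, add_neg_cancel_right]
    exact (B.wrap_of_mem c.2).symm
  · rintro ⟨m, hm, hfix⟩
    have htime : Int.fract z.1.1 + t * Real.cos θ = m + Int.fract z.1.1 := by rw [hm, add_comm]
    refine Subtype.ext ?_
    rw [coe_flow ⟨Int.fract_nonneg _, Int.fract_lt_one _⟩ htime, hfix]
    simp only [Surface.start]
    rw [Int.floor_add_fract, wrap_wrap_add, sub_add_cancel, B.wrap_of_mem z.2]

theorem finite_setOf_fst_eq_abs {S : Set (ℝ × ℝ)} (hS : Bornology.IsBounded S) :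
    {k : ℤ | ∃ p ∈ S, p.1 = |(k : ℝ)|}.Finite := by
  obtain ⟨R, hR⟩ := hS.exists_norm_le
  refine (finite_Icc (-⌈R⌉) ⌈R⌉).subset ?_
  rintro k ⟨p, hp, hk⟩
  have hkR : |(k : ℝ)| ≤ R := hk ▸ (le_abs_self _).trans ((norm_fst_le p).trans (hR p hp))
  rw [mem_Icc, ← abs_le]
  exact_mod_cast hkR.trans (Int.le_ceil R)

namespace IsFreeDirection

theorem cos_ne_zero (hθ : B.IsFreeDirection θ) : Real.cos θ ≠ 0 := by
  intro hcos
  refine hθ 1 one_ne_zero ?_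
  rw [Real.tan_eq_sin_div_cos, hcos, div_zero, mul_zero]
  exact zero_mem _

theorem not_isPeriodic (hθ : B.IsFreeDirection θ) (z : B.Surface) : ¬ B.IsPeriodic θ z := by
  rintro ⟨T, hT, hz⟩
  obtain ⟨m, hm, hfix⟩ := flow_eq_self_iff.mp hz
  have hm0 : m = 0 := hθ.isKeane_edgeExchange.injective_zpow (z.start θ) <|
    hfix.trans (congrArg (· (z.start θ)) (zpow_zero (B.edgeExchange θ))).symm
  rw [hm0, Int.cast_zero] at hm
  exact mul_ne_zero hT.ne' hθ.cos_ne_zero hm.symm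

theorem not_isBounded_of_forall_pos (hθ : B.IsFreeDirection θ) {z : B.Surface} {S : Set (ℝ × ℝ)}
    (h : ∀ i : ℤ, 0 < i → (B.flow θ (z.edgeTime θ i) z).position ∈ S) :
    ¬ Bornology.IsBounded S := by
  intro hS
  refine hθ.notMem_confined (finite_setOf_fst_eq_abs hS) (B.edgeExchange θ (z.start θ)) fun n => ?_
  rw [← Equiv.Perm.mul_apply, ← pow_succ, ← zpow_natCast]
  exact ⟨_, h _ (by positivity), position_flow_edgeTime_fst hθ.cos_ne_zero z _⟩

theorem not_isBounded_of_forall_nonpos (hθ : B.IsFreeDirection θ) {z : B.Surface}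
    {S : Set (ℝ × ℝ)} (h : ∀ i : ℤ, i ≤ 0 → (B.flow θ (z.edgeTime θ i) z).position ∈ S) :
    ¬ Bornology.IsBounded S := by
  intro hS
  have hF := finite_setOf_fst_eq_abs hS
  refine hθ.notMem_confined hF (z.start θ) ?_
  rw [← hθ.isKeane_edgeExchange.confined_inv hF]
  intro n
  rw [inv_pow, ← zpow_natCast, ← zpow_neg]
  exact ⟨_, h _ (by simp), position_flow_edgeTime_fst hθ.cos_ne_zero z _⟩

theorem not_isBounded_forwardSemiOrbit (hθ : B.IsFreeDirection θ) (z : B.Surface) :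
    ¬ Bornology.IsBounded (B.forwardSemiOrbit θ z) := by
  rcases hθ.cos_ne_zero.lt_or_gt with hcos | hcos
  · refine hθ.not_isBounded_of_forall_nonpos (z := z) fun i hi => ⟨_, ?_, rfl⟩
    have hi' : (i : ℝ) ≤ 0 := by exact_mod_cast hi
    exact div_nonneg_of_nonpos (by linarith [Int.fract_nonneg z.1.1]) hcos.le
  · refine hθ.not_isBounded_of_forall_pos (z := z) fun i hi => ⟨_, ?_, rfl⟩
    have hi' : (1 : ℝ) ≤ i := by exact_mod_cast hi
    exact div_nonneg (by linarith [Int.fract_lt_one z.1.1]) hcos.le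

theorem not_isBounded_backwardSemiOrbit (hθ : B.IsFreeDirection θ) (z : B.Surface) :
    ¬ Bornology.IsBounded (B.backwardSemiOrbit θ z) := by
  rcases hθ.cos_ne_zero.lt_or_gt with hcos | hcos
  · refine hθ.not_isBounded_of_forall_pos (z := z) fun i hi => ⟨_, ?_, rfl⟩
    have hi' : (1 : ℝ) ≤ i := by exact_mod_cast hi
    exact div_nonpos_of_nonneg_of_nonpos (by linarith [Int.fract_lt_one z.1.1]) hcos.le
  · refine hθ.not_isBounded_of_forall_nonpos (z := z) fun i hi => ⟨_, ?_, rfl⟩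
    have hi' : (i : ℝ) ≤ 0 := by exact_mod_cast hi
    exact div_nonpos_of_nonpos_of_nonneg (by linarith [Int.fract_nonneg z.1.1]) hcos.le

end IsFreeDirection

theorem countable_setOf_sin_sub_eq_zero (a : ℝ) : {x : ℝ | Real.sin (x - a) = 0}.Countable := by
  refine (countable_range fun n : ℤ => n * Real.pi + a).mono fun x hx => ?_
  obtain ⟨n, hn⟩ := Real.sin_eq_zero_iff.mp hx
  exact ⟨n, by linarith⟩

theorem countable_preimage_tan {s : Set ℝ} (hs : s.Countable) : (Real.tan ⁻¹' s).Countable := by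
  refine ((countable_setOf_sin_sub_eq_zero (Real.pi / 2)).union (hs.biUnion fun y _ =>
    countable_setOf_sin_sub_eq_zero (Real.arctan y))).mono fun x hx => ?_
  by_cases hcos : Real.cos x = 0
  · left
    rw [mem_ofPred, Real.sin_sub_pi_div_two, hcos, neg_zero]
  · refine Or.inr (mem_iUnion₂.mpr ⟨Real.tan x, hx, ?_⟩)
    have hsin : Real.sin (Real.arctan (Real.tan x)) =
        Real.tan x * Real.cos (Real.arctan (Real.tan x)) := by
      rw [← Real.tan_mul_cos (Real.cos_arctan_pos _).ne', Real.tan_arctan]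
    rw [mem_ofPred, Real.sin_sub, hsin, ← Real.tan_mul_cos hcos]
    ring

variable (B) in
theorem countable_setOf_not_isFreeDirection : {θ : ℝ | ¬ B.IsFreeDirection θ}.Countable := by
  refine (countable_preimage_tan (B.countable_heightGroup.image2 (countable_univ (α := ℤ))
    fun h m => h / m)).mono fun θ hθ => ?_
  obtain ⟨m, hm, hmem⟩ := by
    simpa only [mem_ofPred, IsFreeDirection, not_forall, not_not] using hθ
  exact ⟨_, hmem, m, mem_univ m, mul_div_cancel_left₀ _ (Int.cast_ne_zero.mpr hm)⟩

theorem edgeExchange_eq_of_fst_eq {c e : B.Edges} (hfst : e.1.1 = c.1.1 + 1)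
    (hsnd : B.wrap c.1.1 (c.1.2 + Real.tan θ) = e.1.2) : B.edgeExchange θ c = e := by
  have hmem : (B.edgeExchange θ c).1.2 ∈ B.fiber (c.1.1 + 1) := by
    rw [edgeExchange_snd, hsnd, ← hfst]
    exact e.2
  exact Subtype.ext (Prod.ext ((edgeExchange_fst_of_mem hmem).trans hfst.symm) hsnd)

theorem edgeExchange_eq_of_notMem {c e : B.Edges} (hfst : e.1.1 = -(c.1.1 + 1))
    (hsnd : B.wrap c.1.1 (c.1.2 + Real.tan θ) = e.1.2) (he : e.1.2 ∉ B.fiber (c.1.1 + 1)) :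
    B.edgeExchange θ c = e := by
  rw [← hsnd, ← edgeExchange_snd] at he
  exact Subtype.ext (Prod.ext ((edgeExchange_fst_of_notMem he).trans hfst.symm) hsnd)

/-! ### Coexistence in the dyadic billiard -/

/-- The step billiard with heights `2⁻ⁿ`, the example of coexistence. -/
def dyadic : StepBilliard where
  p n := (1 / 2) ^ n
  p_zero := pow_zero _
  p_pos n := by positivity
  p_antitone := pow_right_anti₀ (by norm_num) (by norm_num)
  p_tendsto := tendsto_pow_atTop_nhds_zero_of_lt_one (by norm_num) (by norm_num)

theorem dyadic_height_zero : dyadic.height 0 = 1 := pow_zero _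

theorem dyadic_height_neg_one : dyadic.height (-1) = 1 := pow_zero _

theorem dyadic_height_natCast (n : ℕ) : dyadic.height n = (1 / 2) ^ n := rfl

theorem cos_pi_div_four_pos : 0 < Real.cos (Real.pi / 4) := by
  rw [Real.cos_pi_div_four]
  positivity

theorem dyadic_exists_isPeriodic : ∃ z : dyadic.Surface, dyadic.IsPeriodic (Real.pi / 4) z := by
  have ha : (1 / 4 : ℝ) ∈ dyadic.fiber 0 := by
    rw [fiber, dyadic_height_zero]
    norm_num
  have hb : (-3 / 4 : ℝ) ∈ dyadic.fiber (-1) := by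
    rw [fiber, dyadic_height_neg_one]
    norm_num
  have hwall : (-3 / 4 : ℝ) ∉ dyadic.fiber (0 + 1) := by
    rw [fiber, zero_add, ← Nat.cast_one, dyadic_height_natCast]
    norm_num
  let a : dyadic.Edges := ⟨(0, 1 / 4), ha⟩
  let b : dyadic.Edges := ⟨(-1, -3 / 4), hb⟩
  have hab : dyadic.edgeExchange (Real.pi / 4) a = b := by
    refine edgeExchange_eq_of_notMem rfl (wrap_eq_of_mem hb 1 ?_) hwall
    rw [Real.tan_pi_div_four, dyadic_height_zero]
    norm_num [a]
  have hba : dyadic.edgeExchange (Real.pi / 4) b = a := by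
    refine edgeExchange_eq_of_fst_eq rfl (wrap_eq_of_mem ha 0 ?_)
    rw [Real.tan_pi_div_four]
    norm_num [a, b]
  refine ⟨Surface.ofEdge a, 2 / Real.cos (Real.pi / 4), div_pos two_pos cos_pi_div_four_pos,
    flow_eq_self_iff.mpr ⟨2, ?_, ?_⟩⟩
  · rw [div_mul_cancel₀ _ cos_pi_div_four_pos.ne', Int.cast_ofNat]
  · rw [Surface.start_ofEdge, zpow_ofNat, sq, Equiv.Perm.mul_apply, hab, hba]

theorem dyadic_edgeExchange_axisPoint (n : ℕ) :
    dyadic.edgeExchange (Real.pi / 4) (dyadic.axisPoint (n + 1)) =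
      dyadic.axisPoint (n + 1 + 1) := by
  refine edgeExchange_eq_of_fst_eq rfl (wrap_eq_of_mem (dyadic.axisPoint (n + 1)).2 (2 ^ n) ?_)
  have hheight : dyadic.height (n + 1 : ℤ) = (1 / 2) ^ (n + 1) := dyadic_height_natCast (n + 1)
  have hpow : (2 : ℝ) ^ n * (1 / 2) ^ n = 1 := by rw [← mul_pow]; norm_num
  rw [Real.tan_pi_div_four]
  simp only [axisPoint, hheight, pow_succ]
  push_cast
  linear_combination -hpow

theorem dyadic_edgeExchange_pow_axisPoint_one (n : ℕ) :
    (dyadic.edgeExchange (Real.pi / 4) ^ n) (dyadic.axisPoint 1) = dyadic.axisPoint (n + 1) := by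
  induction n with
  | zero => simp
  | succ n ih =>
    rw [pow_succ', Equiv.Perm.mul_apply, ih, dyadic_edgeExchange_axisPoint, Nat.cast_succ]

theorem dyadic_exists_not_isBounded_trajectory :
    ∃ w : dyadic.Surface, ¬ Bornology.IsBounded (dyadic.trajectory (Real.pi / 4) w) := by
  refine ⟨Surface.ofEdge (dyadic.axisPoint 1), fun hbdd => ?_⟩
  refine infinite_of_injective_forall_mem (f := fun n : ℕ => (n + 1 : ℤ))
    (fun m n hmn => by simpa using hmn) (fun n => ?_) (finite_setOf_fst_eq_abs hbdd)
  refine ⟨_, ⟨(Surface.ofEdge (dyadic.axisPoint 1)).edgeTime (Real.pi / 4) n, rfl⟩, ?_⟩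
  rw [position_flow_edgeTime_fst cos_pi_div_four_pos.ne', Surface.start_ofEdge, zpow_natCast,
    dyadic_edgeExchange_pow_axisPoint_one]
  rfl

end StepBilliard

theorem mainTheorem10_general :
    (∀ B : StepBilliard, {θ : ℝ | ∃ z : B.Surface, B.IsPeriodic θ z ∨
      Bornology.IsBounded (B.forwardSemiOrbit θ z) ∨
      Bornology.IsBounded (B.backwardSemiOrbit θ z)}.Countable) ∧
    (∃ B : StepBilliard, ∃ θ ∈ Ioo (0 : ℝ) (Real.pi / 2), B.PeriodicUnboundedCoexist θ) := by
  refine ⟨fun B => B.countable_setOf_not_isFreeDirection.mono ?_, StepBilliard.dyadic,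
    Real.pi / 4, ?_, StepBilliard.dyadic_exists_isPeriodic,
    StepBilliard.dyadic_exists_not_isBounded_trajectory⟩
  · rintro θ ⟨z, hz | hz | hz⟩ hθ
    exacts [hθ.not_isPeriodic z hz, hθ.not_isBounded_forwardSemiOrbit z hz,
      hθ.not_isBounded_backwardSemiOrbit z hz]
  · constructor <;> linarith [Real.pi_pos]

end

theorem mainTheorem10 :
    (∀ B : StepBilliard, ∀ᵐ θ ∂(volume.restrict (Ioo (0 : ℝ) (Real.pi / 2))),
      ∀ z : B.Surface,
        ¬ Bornology.IsBounded (B.forwardSemiOrbit θ z) ∧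
        ¬ Bornology.IsBounded (B.backwardSemiOrbit θ z)) ∧
    (∀ B : StepBilliard,
      volume {θ : ℝ | θ ∈ Ioo (0 : ℝ) (Real.pi / 2) ∧ B.PeriodicUnboundedCoexist θ} = 0) ∧
    (∃ B : StepBilliard, ∃ θ ∈ Ioo (0 : ℝ) (Real.pi / 2), B.PeriodicUnboundedCoexist θ) := by
  obtain ⟨hcountable, hcoexist⟩ := mainTheorem10_general
  refine ⟨fun B => ?_, fun B => ?_, hcoexist⟩
  · filter_upwards [(hcountable B).ae_notMem (volume.restrict _)] with θ hθ z
    exact ⟨fun h => hθ ⟨z, .inr (.inl h)⟩, fun h => hθ ⟨z, .inr (.inr h)⟩⟩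
  · refine Countable.measure_zero ((hcountable B).mono ?_) volume
    rintro θ ⟨-, ⟨z, hz⟩, -⟩
    exact ⟨z, .inl hz⟩
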